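/- Let $f(z)=\sum_{n=0}^{\infty}a_nz^n$ be an analytic map of the open unit disk $\{|z|<1\}$ into itself, and for $0\le r<1$ let $S_r=S_r(f)<\infty$ denote the area, counted with multiplicity, of the image of $\{|z|<r\}$ under $f$, that is, $S_r=\int_{\mathbb C}\#\{z:|z|<r,\ f(z)=w\}\,dA(w)$ (the area of the Riemann surface of $f^{-1}$ over this image). For $c>0$ put $$D_c(f,r)=\sum_{n=0}^{\infty}|a_n|r^n+\left(\frac1{1+|a_0|}+\frac r{1-r}\right)\sum_{n=1}^{\infty}|a_n|^2r^{2n}+c\,\frac{S_r}{\pi},$$ $$E_c(f,r)=|a_0|^2+\sum_{n=1}^{\infty}|a_n|r^n+\left(\frac1{1+|a_0|}+\frac r{1-r}\right)\sum_{n=1}^{\infty}|a_n|^2r^{2n}+c\,\frac{S_r}{\pi}.$$ All these series converge for $0\le r<1$, and the following hold. (1) $D_{8/9}(f,r)\le 1$ for every such $f$ and all $0\le r\le \frac13$. The numbers $\frac13$ and $\frac89$ cannot be improved: for every $r\in(\frac13,1)$ there is an analytic self-map $f$ of the unit disk with $D_{8/9}(f,r)>1$, and for every $c>\frac89$ there is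 one with $D_c(f,\frac13)>1$. (2) $E_{9/8}(f,r)\le 1$ for every such $f$ and all $0\le r\le \frac1{3-|a_0|}$. The constant $\frac98$ cannot be improved: for every $c>\frac98$ there is an analytic self-map $f$ of the unit disk with $E_c\bigl(f,\frac1{3-|a_0|}\bigr)>1$, where $a_0=f(0)$. -/

import Mathlib

open scoped ENNReal

/-- The class of analytic self-maps of the open unit disk. Only the values on the disk matter. -/
structure IsAnalyticSelfMap (f : ℂ → ℂ) : Prop where
  analytic : AnalyticOnNhd ℂ f (Metric.ball 0 1)
  mapsTo : Set.MapsTo f (Metric.ball 0 1) (Metric.ball 0 1)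

/-- The `n`-th Taylor coefficient of `f` at the origin, so that `f z = ∑ aₙ zⁿ` on the disk. -/
noncomputable def taylorCoeff (f : ℂ → ℂ) (n : ℕ) : ℂ :=
  iteratedDeriv n f 0 / (n.factorial : ℂ)

/-- The area, counted with multiplicity, of the image of `{|z| < r}` under `f`: the area of the
Riemann surface of `f⁻¹` spread over that image. Each point `w` of the plane is weighted by the
number of its preimages in `{|z| < r}`. (Counting a preimage with its order would change the
weight only at critical values, which form a null set.) -/
noncomputable def imageArea (f : ℂ → ℂ) (r : ℝ) : ℝ≥0∞ :=
  ∫⁻ w : ℂ, (({z : ℂ | z ∈ Metric.ball (0 : ℂ) r ∧ f z = w}.encard : ℕ∞) : ℝ≥0∞)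

/-- `(1 / (1 + |a₀|) + r / (1 - r)) ∑_{n ≥ 1} |aₙ|² r²ⁿ + c Sᵣ / π`. -/
noncomputable def refinementTerm (c : ℝ) (f : ℂ → ℂ) (r : ℝ) : ℝ :=
  (1 / (1 + ‖taylorCoeff f 0‖) + r / (1 - r)) *
      ∑' n : ℕ, ‖taylorCoeff f (n + 1)‖ ^ 2 * r ^ (2 * (n + 1))
    + c * ((imageArea f r).toReal / Real.pi)

/-- The refined Bohr sum starting with `|a₀|`, with constant `c` at the area term. -/
noncomputable def bohrSumD (c : ℝ) (f : ℂ → ℂ) (r : ℝ) : ℝ :=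
  (∑' n : ℕ, ‖taylorCoeff f n‖ * r ^ n) + refinementTerm c f r

/-- The refined Bohr sum starting with `|a₀|²`, with constant `c` at the area term. -/
noncomputable def bohrSumE (c : ℝ) (f : ℂ → ℂ) (r : ℝ) : ℝ :=
  ‖taylorCoeff f 0‖ ^ 2 + (∑' n : ℕ, ‖taylorCoeff f (n + 1)‖ * r ^ (n + 1))
    + refinementTerm c f r

open MeasureTheory Filter Topology ComplexConjugate

/-- The power series with coefficients `c` converges to `h` on the open unit disk. -/
def HasDiskSeries (c : ℕ → ℂ) (h : ℂ → ℂ) : Prop :=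
  ∀ z : ℂ, ‖z‖ < 1 → HasSum (fun n => c n * z ^ n) (h z)

theorem hasSum_sq_norm_trigSeries {b : ℕ → ℂ} (hb : Summable fun n => ‖b n‖) {H : ℝ → ℂ}
    (hH : ∀ θ : ℝ, HasSum (fun n => b n * Complex.exp (θ * Complex.I) ^ n) (H θ)) :
    Continuous H ∧
      HasSum (fun n => 2 * Real.pi * ‖b n‖ ^ 2) (∫ θ in -Real.pi..Real.pi, ‖H θ‖ ^ 2) := by
  have hcont : Continuous H := by
    have : H = fun θ : ℝ => ∑' n, b n * Complex.exp (θ * Complex.I) ^ n :=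
      funext fun θ => (hH θ).tsum_eq.symm
    rw [this]
    refine continuous_tsum (fun n => by fun_prop) hb fun n θ => ?_
    simp [Complex.norm_exp_ofReal_mul_I]
  refine ⟨hcont, ?_⟩
  let F : ℕ × ℕ → C(ℝ, ℂ) := fun p =>
    ⟨fun θ => (b p.1 * Complex.exp (θ * Complex.I) ^ p.1) *
      conj (b p.2 * Complex.exp (θ * Complex.I) ^ p.2), by fun_prop⟩
  have hprod : Summable fun p : ℕ × ℕ => ‖b p.1‖ * ‖b p.2‖ := by
    simpa using hb.mul_norm hb
  have hF : Summable fun p => ‖(F p).restrict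
      (⟨Set.uIcc (-Real.pi) Real.pi, isCompact_uIcc⟩ : TopologicalSpace.Compacts ℝ)‖ := by
    refine Summable.of_nonneg_of_le (fun _ => norm_nonneg _) (fun p => ?_) hprod
    refine (ContinuousMap.norm_le _ (by positivity)).2 fun x => ?_
    simp [F, Complex.norm_exp_ofReal_mul_I]
  have hsum := intervalIntegral.hasSum_intervalIntegral_of_summable_norm hF
  have hval : ∀ θ : ℝ, ∑' p, F p θ = ((‖H θ‖ ^ 2 : ℝ) : ℂ) := by
    intro θ
    have h2 : HasSum (fun n => conj (b n * Complex.exp (θ * Complex.I) ^ n)) (conj (H θ)) :=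
      Complex.hasSum_conj'.2 (by simpa using hH θ)
    have hn1 : Summable fun n => ‖b n * Complex.exp (θ * Complex.I) ^ n‖ := by
      simpa [Complex.norm_exp_ofReal_mul_I] using hb
    have hn2 : Summable fun n => ‖conj (b n * Complex.exp (θ * Complex.I) ^ n)‖ := by
      simpa [Complex.norm_exp_ofReal_mul_I] using hb
    have := tsum_mul_tsum_of_summable_norm hn1 hn2
    rw [(hH θ).tsum_eq, h2.tsum_eq, Complex.mul_conj, Complex.normSq_eq_norm_sq] at this
    exact this.symm
  simp_rw [hval] at hsum
  rw [intervalIntegral.integral_ofReal] at hsum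
  have hint : ∀ p : ℕ × ℕ, ∫ θ in -Real.pi..Real.pi, F p θ =
      if p.1 = p.2 then ((2 * Real.pi * ‖b p.1‖ ^ 2 : ℝ) : ℂ) else 0 := by
    rintro ⟨n, m⟩
    have hE : ∀ θ : ℝ, F (n, m) θ =
        (b n * conj (b m)) * Complex.exp ((((n : ℤ) - (m : ℤ) : ℤ) * Complex.I) * θ) := by
      intro θ
      have : conj (Complex.exp (θ * Complex.I)) = Complex.exp (-(θ * Complex.I)) := by
        rw [← Complex.exp_conj]; simp
      simp only [F, ContinuousMap.coe_mk, map_mul, map_pow, this]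
      rw [← Complex.exp_nat_mul, ← Complex.exp_nat_mul]
      calc _ = (b n * conj (b m)) * (Complex.exp (n * (θ * Complex.I)) *
            Complex.exp (m * -(θ * Complex.I))) := by ring
        _ = _ := by
          rw [← Complex.exp_add]; congr 2; push_cast; ring
    simp_rw [hE]
    rw [intervalIntegral.integral_const_mul]
    by_cases hnm : n = m
    · subst hnm
      have : b n * conj (b n) = ((‖b n‖ ^ 2 : ℝ) : ℂ) := by
        rw [Complex.mul_conj, Complex.normSq_eq_norm_sq]
      simp [this]; ring
    · have hk : ((n : ℤ) - (m : ℤ) : ℤ) ≠ 0 := by omega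
      have hk' : ((((n : ℤ) - (m : ℤ) : ℤ) : ℂ) * Complex.I) ≠ 0 :=
        mul_ne_zero (by exact_mod_cast hk) Complex.I_ne_zero
      rw [integral_exp_mul_complex hk', if_neg hnm]
      have : Complex.exp ((((n : ℤ) - (m : ℤ) : ℤ) * Complex.I) * (Real.pi : ℝ)) =
          Complex.exp ((((n : ℤ) - (m : ℤ) : ℤ) * Complex.I) * ((-Real.pi : ℝ) : ℂ)) := by
        rw [Complex.exp_eq_exp_iff_exists_int]
        exact ⟨(n : ℤ) - m, by push_cast; ring⟩
      rw [this]; simp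
  simp_rw [hint] at hsum
  have hinj : Function.Injective fun n : ℕ => (n, n) := fun a b h => (Prod.ext_iff.1 h).1
  rw [← hinj.hasSum_iff] at hsum
  · refine Complex.hasSum_ofReal.1 ?_
    simpa [Function.comp_def] using hsum
  · rintro ⟨n, m⟩ hnm
    refine if_neg fun h => hnm ⟨n, ?_⟩
    simp at h; simp [h]

namespace HasDiskSeries

variable {c d : ℕ → ℂ} {h k : ℂ → ℂ}

theorem summable_norm (hc : HasDiskSeries c h) {r : ℝ} (hr : 0 ≤ r) (hr1 : r < 1) :
    Summable fun n => ‖c n‖ * r ^ n := by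
  have := (hc r (by simpa [abs_of_nonneg hr] using hr1)).summable.norm
  simpa [abs_of_nonneg hr] using this

theorem parseval (hc : HasDiskSeries c h) {r : ℝ} (hr : 0 ≤ r) (hr1 : r < 1) :
    Continuous (fun θ : ℝ => h (r * Complex.exp (θ * Complex.I))) ∧
      HasSum (fun n => 2 * Real.pi * (‖c n‖ ^ 2 * r ^ (2 * n)))
        (∫ θ in -Real.pi..Real.pi, ‖h (r * Complex.exp (θ * Complex.I))‖ ^ 2) := by
  have := hasSum_sq_norm_trigSeries (b := fun n => c n * (r : ℂ) ^ n)
    (H := fun θ : ℝ => h (r * Complex.exp (θ * Complex.I)))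
    (by simpa [abs_of_nonneg hr] using hc.summable_norm hr hr1) (fun θ => by
      convert hc (r * Complex.exp (θ * Complex.I))
        (by simpa [abs_of_nonneg hr, Complex.norm_exp_ofReal_mul_I] using hr1) using 2
      ring)
  refine ⟨this.1, ?_⟩
  convert this.2 using 2 with n
  simp [abs_of_nonneg hr]; ring

theorem mul (hc : HasDiskSeries c h) (hd : HasDiskSeries d k) :
    HasDiskSeries (fun n => ∑ j ∈ Finset.range (n + 1), c j * d (n - j)) (fun z => h z * k z) := by
  intro z hz
  have := hasSum_sum_range_mul_of_summable_norm (hc z hz).summable.norm (hd z hz).summable.norm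
  rw [(hc z hz).tsum_eq, (hd z hz).tsum_eq] at this
  have e : (fun n => (∑ j ∈ Finset.range (n + 1), c j * d (n - j)) * z ^ n) = fun n =>
      ∑ j ∈ Finset.range (n + 1), c j * z ^ j * (d (n - j) * z ^ (n - j)) := by
    funext n
    rw [Finset.sum_mul]
    refine Finset.sum_congr rfl fun j hj => ?_
    have : j + (n - j) = n := by have := Finset.mem_range.1 hj; omega
    rw [show z ^ n = z ^ j * z ^ (n - j) by rw [← pow_add, this]]
    ring
  rw [e]; exact this

theorem sub (hc : HasDiskSeries c h) (hd : HasDiskSeries d k) :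
    HasDiskSeries (fun n => c n - d n) (fun z => h z - k z) := by
  intro z hz
  simpa [sub_mul] using (hc z hz).sub (hd z hz)

theorem const_mul (hc : HasDiskSeries c h) (a : ℂ) :
    HasDiskSeries (fun n => a * c n) (fun z => a * h z) := by
  intro z hz
  simpa [mul_assoc] using (hc z hz).mul_left a

theorem polynomial (g : ℕ → ℂ) (N : ℕ) :
    HasDiskSeries (fun n => if n < N then g n else 0)
      (fun z => ∑ n ∈ Finset.range N, g n * z ^ n) := by
  intro z _
  have : ∀ n ∉ Finset.range N, (if n < N then g n else 0) * z ^ n = 0 := by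
    intro n hn; simp at hn; simp [hn]
  have hs := hasSum_sum_of_ne_finset_zero (L := .unconditional ℕ) this
  convert hs using 1
  refine Finset.sum_congr rfl fun n hn => ?_
  rw [if_pos (Finset.mem_range.1 hn)]

theorem const (a : ℂ) : HasDiskSeries (fun n => if n = 0 then a else 0) (fun _ => a) := by
  intro z _
  convert hasSum_ite_eq (0 : ℕ) a using 2 with n
  split_ifs with hn <;> simp [hn]

theorem unique (hc : HasDiskSeries c h) (hd : HasDiskSeries d h) : c = d := by
  have h0 := (hc.sub hd).parseval (r := 1 / 2) (by norm_num) (by norm_num)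
  simp only [sub_self, norm_zero, ne_eq, OfNat.ofNat_ne_zero, not_false_eq_true, zero_pow,
    intervalIntegral.integral_zero] at h0
  have := (hasSum_zero_iff_of_nonneg (fun n => by positivity)).1 h0.2
  funext n
  have hn := congrFun this n
  simpa [Real.pi_ne_zero, sub_eq_zero] using hn

/-- Multiplication by a function bounded by one is a contraction on truncated power series. -/
theorem contraction (hc : HasDiskSeries c h) (hh : ∀ z : ℂ, ‖z‖ < 1 → ‖h z‖ ≤ 1)
    (g : ℕ → ℂ) (N : ℕ) :
    ∑ n ∈ Finset.range N, ‖∑ j ∈ Finset.range (n + 1), g j * c (n - j)‖ ^ 2 ≤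
      ∑ n ∈ Finset.range N, ‖g n‖ ^ 2 := by
  have hp := polynomial g N
  have hm := hp.mul hc
  have key : ∀ r : ℝ, 0 ≤ r → r < 1 →
      ∑ n ∈ Finset.range N, ‖∑ j ∈ Finset.range (n + 1), g j * c (n - j)‖ ^ 2 * r ^ (2 * n) ≤
      ∑ n ∈ Finset.range N, ‖g n‖ ^ 2 * r ^ (2 * n) := by
    intro r hr hr1
    obtain ⟨hc1, hs1⟩ := hm.parseval hr hr1
    obtain ⟨hc2, hs2⟩ := hp.parseval hr hr1
    have hle := intervalIntegral.integral_mono_on (μ := volume) (a := -Real.pi) (b := Real.pi)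
      (by linarith [Real.pi_pos]) ((hc1.norm.pow 2).intervalIntegrable _ _)
      ((hc2.norm.pow 2).intervalIntegrable _ _) (fun θ _ => by
        have hb := hh (r * Complex.exp (θ * Complex.I))
          (by simpa [abs_of_nonneg hr, Complex.norm_exp_ofReal_mul_I] using hr1)
        refine pow_le_pow_left₀ (norm_nonneg _) ?_ 2
        rw [norm_mul]
        exact mul_le_of_le_one_right (norm_nonneg _) hb)
    have h1 := sum_le_hasSum (Finset.range N) (fun n _ => by positivity) hs1
    have h2 := hs2.unique (hasSum_sum_of_ne_finset_zero (s := Finset.range N) (fun n hn => by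
      simp at hn; simp [hn]))
    simp only [Pi.pow_apply] at hle
    rw [h2, ← Finset.mul_sum] at hle
    rw [← Finset.mul_sum] at h1
    have h3 := le_of_mul_le_mul_left (h1.trans hle) (by positivity)
    refine le_trans (le_of_eq ?_) (h3.trans (le_of_eq ?_))
    · refine Finset.sum_congr rfl fun n hn => ?_
      congr 3
      refine Finset.sum_congr rfl fun j hj => ?_
      rw [if_pos]
      have := Finset.mem_range.1 hj; have := Finset.mem_range.1 hn; omega
    · refine Finset.sum_congr rfl fun n hn => ?_
      rw [if_pos (Finset.mem_range.1 hn)]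
  have hL : Tendsto (fun r : ℝ => ∑ n ∈ Finset.range N,
      ‖∑ j ∈ Finset.range (n + 1), g j * c (n - j)‖ ^ 2 * r ^ (2 * n)) (𝓝[<] 1)
      (𝓝 (∑ n ∈ Finset.range N, ‖∑ j ∈ Finset.range (n + 1), g j * c (n - j)‖ ^ 2)) := by
    have : Continuous (fun r : ℝ => ∑ n ∈ Finset.range N,
      ‖∑ j ∈ Finset.range (n + 1), g j * c (n - j)‖ ^ 2 * r ^ (2 * n)) := by fun_prop
    simpa using this.continuousAt.continuousWithinAt.tendsto (x := 1) (s := Set.Iio 1)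
  have hR : Tendsto (fun r : ℝ => ∑ n ∈ Finset.range N, ‖g n‖ ^ 2 * r ^ (2 * n)) (𝓝[<] 1)
      (𝓝 (∑ n ∈ Finset.range N, ‖g n‖ ^ 2)) := by
    have : Continuous (fun r : ℝ => ∑ n ∈ Finset.range N, ‖g n‖ ^ 2 * r ^ (2 * n)) := by fun_prop
    simpa using this.continuousAt.continuousWithinAt.tendsto (x := 1) (s := Set.Iio 1)
  refine le_of_tendsto_of_tendsto hL hR ?_
  filter_upwards [Ico_mem_nhdsLT (show (0 : ℝ) < 1 by norm_num)] with r hr using key r hr.1 hr.2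

end HasDiskSeries

theorem hasDiskSeries_of_differentiableOn {f : ℂ → ℂ}
    (hf : DifferentiableOn ℂ f (Metric.ball 0 1)) : HasDiskSeries (taylorCoeff f) f := by
  intro z hz
  have := Complex.hasSum_taylorSeries_on_ball hf (z := z) (by simpa using hz)
  have e : (fun n => taylorCoeff f n * z ^ n) =
      fun n : ℕ => (n.factorial : ℂ)⁻¹ • (z - 0) ^ n • iteratedDeriv n f 0 := by
    funext n
    simp [taylorCoeff]; ring
  rw [e]; exact this

theorem IsAnalyticSelfMap.hasDiskSeries {f : ℂ → ℂ} (hf : IsAnalyticSelfMap f) :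
    HasDiskSeries (taylorCoeff f) f :=
  hasDiskSeries_of_differentiableOn hf.analytic.differentiableOn

theorem hasDiskSeries_deriv {f : ℂ → ℂ} (hf : AnalyticOnNhd ℂ f (Metric.ball 0 1)) :
    HasDiskSeries (fun n => (n + 1) * taylorCoeff f (n + 1)) (deriv f) := by
  have := hasDiskSeries_of_differentiableOn hf.deriv.differentiableOn
  have e : (fun n : ℕ => (n + 1) * taylorCoeff f (n + 1)) = taylorCoeff (deriv f) := by
    funext n
    simp only [taylorCoeff, ← iteratedDeriv_succ', Nat.factorial_succ]
    push_cast
    have : (n + 1 : ℂ) ≠ 0 := by exact_mod_cast n.succ_ne_zero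
    field_simp
  rw [e]; exact this

theorem exists_norm_one_mul_norm (w : ℂ) : ∃ t : ℂ, ‖t‖ = 1 ∧ w = ‖w‖ * t := by
  by_cases hw : w = 0
  · exact ⟨1, by simp, by simp [hw]⟩
  · have : (‖w‖ : ℂ) ≠ 0 := by exact_mod_cast norm_ne_zero_iff.2 hw
    exact ⟨w / ‖w‖, by simp [hw], by field_simp⟩

namespace HasDiskSeries

variable {c : ℕ → ℂ} {h : ℂ → ℂ}

theorem apply_zero (hc : HasDiskSeries c h) : h 0 = c 0 := by
  refine (hc 0 (by simp)).unique ?_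
  convert hasSum_ite_eq (0 : ℕ) (c 0) using 2 with n
  rcases n with _ | n <;> simp

/-- The contraction inequality tested on `1 + μ zⁿ` plus a reversed conjugate partial sum. -/
theorem contraction_reversed (hc : HasDiskSeries c h) (hh : ∀ z : ℂ, ‖z‖ < 1 → ‖h z‖ ≤ 1)
    {n L : ℕ} (hL : 1 ≤ L) (hLn : L ≤ n + 1) {μ t : ℂ} (hμ : n = 0 → μ = 0) (ht : ‖t‖ = 1) :
    ∑ k ∈ Finset.range n, ‖c k‖ ^ 2 + ‖c n + μ * c 0‖ ^ 2 +
        ‖c (n + L) + μ * c L + t * (∑ i ∈ Finset.range L, ‖c i‖ ^ 2 : ℝ)‖ ^ 2 ≤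
      1 + ‖μ‖ ^ 2 + ∑ i ∈ Finset.range L, ‖c i‖ ^ 2 := by
  set g : ℕ → ℂ := fun j => if j < n + 1 then (if j = 0 then 1 else 0) + (if j = n then μ else 0)
    else t * conj (c (n + L - j)) with hg
  have hcon := hc.contraction hh g (n + 1 + L)
  have hgs : ∀ j, j < n + 1 → g j = (if j = 0 then 1 else 0) + (if j = n then μ else 0) :=
    fun j hj => if_pos hj
  have hgl : ∀ i, i < L → g (n + 1 + i) = t * conj (c (L - 1 - i)) := by
    intro i hi
    simp only [hg]
    rw [if_neg (by omega), show n + L - (n + 1 + i) = L - 1 - i by omega]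
  have hR : ∑ j ∈ Finset.range (n + 1 + L), ‖g j‖ ^ 2 =
      1 + ‖μ‖ ^ 2 + ∑ i ∈ Finset.range L, ‖c i‖ ^ 2 := by
    rw [Finset.sum_range_add]
    congr 1
    · rw [Finset.sum_congr rfl fun j hj => by rw [hgs j (Finset.mem_range.1 hj)]]
      rcases n with _ | n
      · simp [hμ rfl]
      · rw [Finset.sum_range_succ, Finset.sum_range_succ', Finset.sum_eq_zero]
        · simp
        · intro j hj
          have := Finset.mem_range.1 hj
          simp [this.ne]
    · rw [← Finset.sum_range_reflect (fun i => ‖c i‖ ^ 2) L]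
      refine Finset.sum_congr rfl fun i hi => ?_
      rw [hgl i (Finset.mem_range.1 hi)]
      simp [ht]
  have hshort : ∀ k : ℕ, k ≤ n → ∀ m : ℕ, k ≤ m → ∑ j ∈ Finset.range (k + 1), g j * c (m - j) =
      c m + if k = n then μ * c (m - n) else 0 := by
    intro k hk m hm
    have : ∀ j ∈ Finset.range (k + 1), g j * c (m - j) =
        (if j = 0 then c m else 0) + (if j = n then μ * c (m - n) else 0) := by
      intro j hj
      have := Finset.mem_range.1 hj
      rw [hgs j (by omega), add_mul]
      congr 1
      · split_ifs with h0 <;> simp [h0]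
      · split_ifs with h0 <;> simp [h0]
    rw [Finset.sum_congr rfl this, Finset.sum_add_distrib, Finset.sum_ite_eq', Finset.sum_ite_eq',
      if_pos (by simp)]
    congr 1
    by_cases hkn : k = n
    · simp [hkn]
    · rw [if_neg hkn, if_neg]
      simp; omega
  have hlast : ∑ j ∈ Finset.range (n + L + 1), g j * c (n + L - j) =
      c (n + L) + μ * c L + t * (∑ i ∈ Finset.range L, ‖c i‖ ^ 2 : ℝ) := by
    rw [show n + L + 1 = n + 1 + L by ring, Finset.sum_range_add, hshort n le_rfl _ (by omega),
      if_pos rfl, Nat.add_sub_cancel_left]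
    congr 1
    rw [← Finset.sum_range_reflect (fun i => ‖c i‖ ^ 2) L]
    push_cast
    rw [Finset.mul_sum]
    refine Finset.sum_congr rfl fun i hi => ?_
    have hi := Finset.mem_range.1 hi
    rw [hgl i hi, show n + L - (n + 1 + i) = L - 1 - i by omega, mul_assoc, mul_comm (conj _),
      Complex.mul_conj, Complex.normSq_eq_norm_sq]
    push_cast; rfl
  rw [hR, Finset.sum_range_add] at hcon
  refine le_trans ?_ hcon
  refine add_le_add (le_of_eq ?_) ?_
  · rw [Finset.sum_range_succ]
    congr 1
    · refine Finset.sum_congr rfl fun k hk => ?_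
      have hk := Finset.mem_range.1 hk
      rw [hshort k hk.le k le_rfl, if_neg hk.ne, add_zero]
    · rw [hshort n le_rfl n le_rfl, if_pos rfl, Nat.sub_self]
  · have hmem : L - 1 ∈ Finset.range L := Finset.mem_range.2 (by omega)
    refine le_trans (le_of_eq ?_) (Finset.single_le_sum
      (f := fun i => ‖∑ j ∈ Finset.range (n + 1 + i + 1), g j * c (n + 1 + i - j)‖ ^ 2)
      (fun i _ => by positivity) hmem)
    simp only [show n + 1 + (L - 1) = n + L by omega]
    rw [hlast]

theorem norm_odd_add_sum_sq_le_one (hc : HasDiskSeries c h)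
    (hh : ∀ z : ℂ, ‖z‖ < 1 → ‖h z‖ ≤ 1) (n : ℕ) :
    ‖c (2 * n + 1)‖ + ∑ k ∈ Finset.range (n + 1), ‖c k‖ ^ 2 ≤ 1 := by
  obtain ⟨t, ht, hct⟩ := exists_norm_one_mul_norm (c (2 * n + 1))
  have := hc.contraction_reversed hh (n := n) (L := n + 1) (by omega) le_rfl (μ := 0)
    (fun _ => rfl) ht
  set s := ∑ k ∈ Finset.range (n + 1), ‖c k‖ ^ 2 with hs
  have hs0 : 0 ≤ s := Finset.sum_nonneg fun _ _ => by positivity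
  rw [show n + (n + 1) = 2 * n + 1 by ring] at this
  simp only [zero_mul, add_zero, norm_zero] at this
  rw [← Finset.sum_range_succ (fun k => ‖c k‖ ^ 2), ← hs] at this
  have e : ‖c (2 * n + 1) + t * s‖ = ‖c (2 * n + 1)‖ + s := by
    conv_lhs => rw [hct]
    rw [show (‖c (2 * n + 1)‖ : ℂ) * t + t * s = t * ((‖c (2 * n + 1)‖ + s : ℝ) : ℂ) by
      push_cast; ring, norm_mul, ht, Complex.norm_real, Real.norm_of_nonneg (by positivity), one_mul]
  rw [e] at this
  have h0 := norm_nonneg (c (2 * n + 1))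
  nlinarith

theorem norm_even_add_sum_sq_le_one (hc : HasDiskSeries c h)
    (hh : ∀ z : ℂ, ‖z‖ < 1 → ‖h z‖ ≤ 1) {n : ℕ} (hn : 1 ≤ n) :
    ‖c (2 * n)‖ + ∑ k ∈ Finset.range n, ‖c k‖ ^ 2 + ‖c n‖ ^ 2 / (1 + ‖c 0‖) ≤ 1 := by
  obtain ⟨t, ht, hct⟩ := exists_norm_one_mul_norm (c (2 * n))
  obtain ⟨τ, hτ, hcτ⟩ := exists_norm_one_mul_norm (c n)
  set a := ‖c 0‖ with ha
  set b := ‖c n‖ with hb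
  have ha0 : 0 ≤ a := norm_nonneg _
  have hb0 : 0 ≤ b := norm_nonneg _
  set m := b / (1 + a) with hm
  have hm0 : 0 ≤ m := by positivity
  have hbm : b = m + m * a := by rw [hm]; field_simp
  have := hc.contraction_reversed hh (n := n) (L := n) hn (by omega) (μ := t * m * conj τ)
    (by omega) ht
  set s := ∑ k ∈ Finset.range n, ‖c k‖ ^ 2 with hs
  have hs0 : 0 ≤ s := Finset.sum_nonneg fun _ _ => by positivity
  rw [show n + n = 2 * n by ring] at this
  have hμ : ‖t * m * conj τ‖ = m := by simp [ht, hτ, abs_of_nonneg hm0]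
  have hττ : τ * conj τ = 1 := by rw [Complex.mul_conj, Complex.normSq_eq_norm_sq, hτ]; simp
  have e : ‖c (2 * n) + t * m * conj τ * c n + t * s‖ = ‖c (2 * n)‖ + m * b + s := by
    have : c (2 * n) + t * m * conj τ * c n + t * s =
        t * ((‖c (2 * n)‖ + m * b + s : ℝ) : ℂ) := by
      calc _ = (‖c (2 * n)‖ : ℂ) * t + t * m * conj τ * (b * τ) + t * s := by rw [← hct, ← hcτ]
        _ = (‖c (2 * n)‖ : ℂ) * t + t * m * b * (τ * conj τ) + t * s := by ring
        _ = _ := by rw [hττ]; push_cast; ring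
    rw [this, norm_mul, ht, Complex.norm_real, Real.norm_of_nonneg (by positivity), one_mul]
  have e2 : m ≤ ‖c n + t * m * conj τ * c 0‖ := by
    have h1 := norm_sub_norm_le (c n) (-(t * m * conj τ * c 0))
    rw [norm_neg, norm_mul, hμ, sub_neg_eq_add] at h1
    have : b - m * a = m := by rw [hbm]; ring
    linarith
  rw [e, hμ] at this
  have e3 : m ^ 2 ≤ ‖c n + t * m * conj τ * c 0‖ ^ 2 := pow_le_pow_left₀ hm0 e2 2
  have h0 := norm_nonneg (c (2 * n))
  have e4 : b ^ 2 / (1 + a) = m * b := by rw [hm]; ring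
  rw [e4]
  have : (‖c (2 * n)‖ + m * b + s) ^ 2 ≤ 1 := by linarith
  have hmb : 0 ≤ m * b := by positivity
  nlinarith

theorem sum_sq_norm_le_one (hc : HasDiskSeries c h) (hh : ∀ z : ℂ, ‖z‖ < 1 → ‖h z‖ ≤ 1) (n : ℕ) :
    ∑ k ∈ Finset.range n, ‖c k‖ ^ 2 ≤ 1 := by
  have h1 := hc.norm_odd_add_sum_sq_le_one hh n
  rw [Finset.sum_range_succ] at h1
  nlinarith [norm_nonneg (c (2 * n + 1)), sq_nonneg ‖c n‖]

theorem norm_coeff_le_one (hc : HasDiskSeries c h) (hh : ∀ z : ℂ, ‖z‖ < 1 → ‖h z‖ ≤ 1) (n : ℕ) :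
    ‖c n‖ ≤ 1 := by
  have h1 := hc.sum_sq_norm_le_one hh (n + 1)
  have h2 := Finset.single_le_sum (f := fun k => ‖c k‖ ^ 2) (fun _ _ => by positivity)
    (Finset.self_mem_range_succ n)
  nlinarith [norm_nonneg (c n)]

end HasDiskSeries

theorem normSq_one_sub_conj_mul_sub_normSq_sub (a z : ℂ) :
    ‖1 - conj a * z‖ ^ 2 - ‖z - a‖ ^ 2 = (1 - ‖a‖ ^ 2) * (1 - ‖z‖ ^ 2) := by
  simp only [← Complex.normSq_eq_norm_sq, Complex.normSq_apply, Complex.sub_re, Complex.sub_im,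
    Complex.mul_re, Complex.mul_im, Complex.conj_re, Complex.conj_im, Complex.one_re,
    Complex.one_im]
  ring

theorem one_sub_conj_mul_ne_zero {a z : ℂ} (ha : ‖a‖ < 1) (hz : ‖z‖ < 1) : 1 - conj a * z ≠ 0 := by
  intro h0
  have : ‖conj a * z‖ = 1 := by rw [← sub_eq_zero.1 h0]; simp
  rw [norm_mul, RCLike.norm_conj] at this
  nlinarith [norm_nonneg a, norm_nonneg z]

theorem norm_moebius_lt_one {a z : ℂ} (ha : ‖a‖ < 1) (hz : ‖z‖ < 1) :
    ‖(z - a) / (1 - conj a * z)‖ < 1 := by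
  have h0 := one_sub_conj_mul_ne_zero ha hz
  rw [norm_div, div_lt_one (norm_pos_iff.2 h0)]
  refine lt_of_pow_lt_pow_left₀ 2 (norm_nonneg _) ?_
  have := normSq_one_sub_conj_mul_sub_normSq_sub a z
  have h1 : 0 < (1 - ‖a‖ ^ 2) * (1 - ‖z‖ ^ 2) := by
    refine mul_pos ?_ ?_ <;> nlinarith [norm_nonneg a, norm_nonneg z]
  linarith

namespace IsAnalyticSelfMap

variable {f : ℂ → ℂ}

theorem norm_lt_one (hf : IsAnalyticSelfMap f) {z : ℂ} (hz : ‖z‖ < 1) : ‖f z‖ < 1 := by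
  simpa using hf.mapsTo (x := z) (by simpa using hz)

theorem norm_coeff_zero_lt_one (hf : IsAnalyticSelfMap f) : ‖taylorCoeff f 0‖ < 1 := by
  rw [← hf.hasDiskSeries.apply_zero]
  exact hf.norm_lt_one (by simp)

theorem sum_sq_coeff_succ_le_step (hf : IsAnalyticSelfMap f) (n : ℕ) :
    ∑ k ∈ Finset.range (n + 1), ‖taylorCoeff f (k + 1)‖ ^ 2 ≤
      (1 - ‖taylorCoeff f 0‖ ^ 2) ^ 2 +
        ‖taylorCoeff f 0‖ ^ 2 * ∑ k ∈ Finset.range n, ‖taylorCoeff f (k + 1)‖ ^ 2 := by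
  set c := taylorCoeff f with hcdef
  have hc : HasDiskSeries c f := hf.hasDiskSeries
  have ha : ‖c 0‖ < 1 := hf.norm_coeff_zero_lt_one
  set w : ℂ → ℂ := fun z => (f z - c 0) / (1 - conj (c 0) * f z) with hwdef
  have hne : ∀ z : ℂ, ‖z‖ < 1 → 1 - conj (c 0) * f z ≠ 0 := fun z hz =>
    one_sub_conj_mul_ne_zero ha (hf.norm_lt_one hz)
  have hfd := hf.analytic.differentiableOn
  have hw : HasDiskSeries (taylorCoeff w) w := by
    refine hasDiskSeries_of_differentiableOn ?_
    refine (hfd.sub_const _).div ((hfd.const_mul _).const_sub _) fun z hz => ?_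
    exact hne z (by simpa using hz)
  have hwle : ∀ z : ℂ, ‖z‖ < 1 → ‖w z‖ ≤ 1 := fun z hz =>
    (norm_moebius_lt_one ha (hf.norm_lt_one hz)).le
  set u := taylorCoeff w with hu
  have hu0 : u 0 = 0 := by
    rw [← hw.apply_zero, hwdef]; simp [hc.apply_zero]
  set d : ℕ → ℂ := fun n => (if n = 0 then 1 else 0) - conj (c 0) * c n with hd
  have hprod := ((HasDiskSeries.const 1).sub (hc.const_mul (conj (c 0)))).mul hw
  have hdiff := hc.sub (HasDiskSeries.const (c 0))
  have hcoef : ∀ k, ∑ j ∈ Finset.range (k + 1), d j * u (k - j) =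
      c k - if k = 0 then c 0 else 0 := by
    have heq : HasDiskSeries (fun k => ∑ j ∈ Finset.range (k + 1), d j * u (k - j))
        (fun z => f z - c 0) := by
      intro z hz
      have := hprod z hz
      have e : (1 - conj (c 0) * f z) * w z = f z - c 0 := by
        rw [hwdef]; field_simp [hne z hz]
      simpa only [e] using this
    exact fun k => congrFun (heq.unique hdiff) k
  have hcon := hw.contraction hwle (fun j => if j < n + 1 then d j else 0) (n + 2)
  rw [Finset.sum_range_succ', Finset.sum_range_succ (fun j => ‖if j < n + 1 then d j else 0‖ ^ 2),
    Finset.sum_range_succ' (fun j => ‖if j < n + 1 then d j else 0‖ ^ 2)] at hcon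
  have hL : ∀ k ∈ Finset.range (n + 1), ‖∑ j ∈ Finset.range (k + 1 + 1),
      (if j < n + 1 then d j else 0) * u (k + 1 - j)‖ ^ 2 = ‖c (k + 1)‖ ^ 2 := by
    intro k hk
    have hk := Finset.mem_range.1 hk
    have : ∑ j ∈ Finset.range (k + 1 + 1), (if j < n + 1 then d j else 0) * u (k + 1 - j) =
        ∑ j ∈ Finset.range (k + 1 + 1), d j * u (k + 1 - j) := by
      refine Finset.sum_congr rfl fun j hj => ?_
      have hj := Finset.mem_range.1 hj
      split_ifs with hjn
      · rfl
      · rw [show k + 1 - j = 0 by omega, hu0]; simp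
    rw [this, hcoef]
    simp
  have hR : ∀ j ∈ Finset.range n, ‖if j + 1 < n + 1 then d (j + 1) else 0‖ ^ 2 =
      ‖c 0‖ ^ 2 * ‖c (j + 1)‖ ^ 2 := by
    intro j hj
    rw [if_pos (by have := Finset.mem_range.1 hj; omega)]
    simp [hd, mul_pow]
  have hd0 : ‖d 0‖ ^ 2 = (1 - ‖c 0‖ ^ 2) ^ 2 := by
    have : d 0 = ((1 - ‖c 0‖ ^ 2 : ℝ) : ℂ) := by
      simp only [hd, if_pos]
      rw [mul_comm, Complex.mul_conj, Complex.normSq_eq_norm_sq]; push_cast; rfl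
    rw [this, Complex.norm_real, Real.norm_eq_abs, sq_abs]
  rw [Finset.sum_congr rfl hL, Finset.sum_congr rfl hR, ← Finset.mul_sum, if_pos (by omega),
    if_neg (by omega), hd0] at hcon
  simp only [norm_zero] at hcon
  nlinarith [sq_nonneg ‖∑ j ∈ Finset.range (0 + 1), (if j < n + 1 then d j else 0) * u (0 - j)‖]

theorem sum_sq_coeff_succ_le (hf : IsAnalyticSelfMap f) (n : ℕ) :
    ∑ k ∈ Finset.range n, ‖taylorCoeff f (k + 1)‖ ^ 2 ≤
      ∑ k ∈ Finset.range n, (1 - ‖taylorCoeff f 0‖ ^ 2) ^ 2 * (‖taylorCoeff f 0‖ ^ 2) ^ k := by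
  induction n with
  | zero => simp
  | succ n ih =>
    refine (hf.sum_sq_coeff_succ_le_step n).trans ?_
    rw [Finset.sum_range_succ' (fun k => (1 - ‖taylorCoeff f 0‖ ^ 2) ^ 2 * _), add_comm]
    have : ∑ k ∈ Finset.range n, (1 - ‖taylorCoeff f 0‖ ^ 2) ^ 2 *
        (‖taylorCoeff f 0‖ ^ 2) ^ (k + 1) = ‖taylorCoeff f 0‖ ^ 2 *
        ∑ k ∈ Finset.range n, (1 - ‖taylorCoeff f 0‖ ^ 2) ^ 2 * (‖taylorCoeff f 0‖ ^ 2) ^ k := by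
      rw [Finset.mul_sum]
      exact Finset.sum_congr rfl fun k _ => by ring
    rw [this, pow_zero, mul_one]
    gcongr

end IsAnalyticSelfMap

theorem summable_bounded_mul_pow {A : ℕ → ℝ} {C q : ℝ} (hA : ∀ n, 0 ≤ A n) (hAC : ∀ n, A n ≤ C)
    (hq : 0 ≤ q) (hq1 : q < 1) : Summable fun n => A n * q ^ n :=
  Summable.of_nonneg_of_le (fun n => mul_nonneg (hA n) (by positivity))
    (fun n => mul_le_mul_of_nonneg_right (hAC n) (by positivity))
    ((summable_geometric_of_lt_one hq hq1).mul_left C)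

theorem tsum_partialSum_mul_pow {B : ℕ → ℝ} {C q : ℝ} (hB : ∀ n, 0 ≤ B n)
    (hBC : ∀ n, ∑ k ∈ Finset.range n, B k ≤ C) (hq : 0 ≤ q) (hq1 : q < 1) :
    (1 - q) * ∑' n, (∑ k ∈ Finset.range n, B k) * q ^ n = ∑' n, B n * q ^ (n + 1) := by
  have hT : Summable fun n => (∑ k ∈ Finset.range n, B k) * q ^ n :=
    summable_bounded_mul_pow (fun n => Finset.sum_nonneg fun k _ => hB k) hBC hq hq1
  have hBC' : ∀ n, B n ≤ C := fun n =>
    (Finset.single_le_sum (fun k _ => hB k) (Finset.self_mem_range_succ n)).trans (hBC (n + 1))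
  have hB' := summable_bounded_mul_pow hB hBC' hq hq1
  have h1 := hT.tsum_eq_zero_add
  have h2 : ∀ n, (∑ k ∈ Finset.range (n + 1), B k) * q ^ (n + 1) =
      q * ((∑ k ∈ Finset.range n, B k) * q ^ n) + q * (B n * q ^ n) := by
    intro n; rw [Finset.sum_range_succ]; ring
  simp_rw [h2] at h1
  rw [(hT.mul_left q).tsum_add (hB'.mul_left q), tsum_mul_left, tsum_mul_left] at h1
  have h3 : ∑' n, B n * q ^ (n + 1) = q * ∑' n, B n * q ^ n := by
    rw [← tsum_mul_left]; exact tsum_congr fun n => by ring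
  rw [h3]
  simp only [Finset.range_zero, Finset.sum_empty, zero_mul, zero_add] at h1
  linarith

theorem tsum_odd_mul_pow_le {X T : ℕ → ℝ} {D r : ℝ} (hr : 0 ≤ r) (hr1 : r < 1)
    (hX : Summable fun n => X (2 * n + 1) * r ^ (2 * n + 1))
    (hT : Summable fun n => T n * (r ^ 2) ^ n) (hXT : ∀ n, X (2 * n + 1) ≤ D - T n) :
    ∑' n, X (2 * n + 1) * r ^ (2 * n + 1) ≤
      D * r * (1 - r ^ 2)⁻¹ - r * ∑' n, T n * (r ^ 2) ^ n := by
  have hq1 : r ^ 2 < 1 := by nlinarith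
  have hgeo := (summable_geometric_of_lt_one (sq_nonneg r) hq1).mul_left (D * r)
  rw [← tsum_geometric_of_lt_one (sq_nonneg r) hq1, ← tsum_mul_left, ← tsum_mul_left,
    ← hgeo.tsum_sub (hT.mul_left r)]
  refine hX.tsum_le_tsum (fun n => ?_) (hgeo.sub (hT.mul_left r))
  calc X (2 * n + 1) * r ^ (2 * n + 1) ≤ (D - T n) * r ^ (2 * n + 1) :=
        mul_le_mul_of_nonneg_right (hXT n) (by positivity)
    _ = _ := by ring

theorem tsum_even_mul_pow_le {X T B : ℕ → ℝ} {D E r : ℝ} (hr : 0 ≤ r) (hr1 : r < 1)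
    (hX : Summable fun n => X (2 * (n + 1)) * r ^ (2 * (n + 1)))
    (hT : Summable fun n => T n * (r ^ 2) ^ n) (hB : Summable fun n => B n * (r ^ 2) ^ (n + 1))
    (hXT : ∀ n, X (2 * (n + 1)) ≤ D - T n - E * B n) :
    ∑' n, X (2 * (n + 1)) * r ^ (2 * (n + 1)) ≤
      D * r ^ 2 * (1 - r ^ 2)⁻¹ - r ^ 2 * ∑' n, T n * (r ^ 2) ^ n -
        E * ∑' n, B n * (r ^ 2) ^ (n + 1) := by
  have hq1 : r ^ 2 < 1 := by nlinarith
  have hgeo := (summable_geometric_of_lt_one (sq_nonneg r) hq1).mul_left (D * r ^ 2)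
  have hsub := hgeo.sub (hT.mul_left (r ^ 2))
  rw [← tsum_geometric_of_lt_one (sq_nonneg r) hq1, ← tsum_mul_left, ← tsum_mul_left,
    ← tsum_mul_left, ← hgeo.tsum_sub (hT.mul_left (r ^ 2)), ← hsub.tsum_sub (hB.mul_left E)]
  refine hX.tsum_le_tsum (fun n => ?_) (hsub.sub (hB.mul_left E))
  calc X (2 * (n + 1)) * r ^ (2 * (n + 1)) ≤ (D - T n - E * B n) * r ^ (2 * (n + 1)) :=
        mul_le_mul_of_nonneg_right (hXT n) (by positivity)
    _ = _ := by ring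

theorem geometric_split_identity {r G Q D E : ℝ} (hr : 0 ≤ r) (hr1 : r < 1)
    (hG : (1 - r ^ 2) * G = Q) :
    (D * r * (1 - r ^ 2)⁻¹ - r * G) + (D * r ^ 2 * (1 - r ^ 2)⁻¹ - r ^ 2 * G - E * Q) +
      (E + r / (1 - r)) * Q = D * (r / (1 - r)) := by
  have h1 : 1 - r ≠ 0 := by linarith
  have h2 : 1 + r ≠ 0 := by linarith
  have h3 : 1 - r ^ 2 = (1 - r) * (1 + r) := by ring
  rw [← hG, h3]
  field_simp
  ring

/-- Summing Carlson's inequalities against powers of `r`. -/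
theorem tsum_mul_pow_add_le {A : ℕ → ℝ} (hA : ∀ n, 0 ≤ A n) (hA1 : ∀ n, A n ≤ 1)
    (hodd : ∀ n, A (2 * n + 1) + ∑ k ∈ Finset.range (n + 1), A k ^ 2 ≤ 1)
    (heven : ∀ n, A (2 * (n + 1)) + ∑ k ∈ Finset.range (n + 1), A k ^ 2
      + A (n + 1) ^ 2 / (1 + A 0) ≤ 1) {r : ℝ} (hr : 0 ≤ r) (hr1 : r < 1) :
    ∑' n, A (n + 1) * r ^ (n + 1) +
      (1 / (1 + A 0) + r / (1 - r)) * ∑' n, A (n + 1) ^ 2 * r ^ (2 * (n + 1)) ≤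
      (1 - A 0 ^ 2) * (r / (1 - r)) := by
  have hq : 0 ≤ r ^ 2 := by positivity
  have hq1 : r ^ 2 < 1 := by nlinarith
  have hsucc : ∀ n, ∑ k ∈ Finset.range (n + 1), A k ^ 2 =
      ∑ k ∈ Finset.range n, A (k + 1) ^ 2 + A 0 ^ 2 := fun n => Finset.sum_range_succ' _ n
  have hT0 : ∀ n, 0 ≤ ∑ k ∈ Finset.range n, A (k + 1) ^ 2 :=
    fun n => Finset.sum_nonneg fun k _ => by positivity
  have hT1 : ∀ n, ∑ k ∈ Finset.range n, A (k + 1) ^ 2 ≤ 1 := fun n => by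
    linarith [hodd n, hsucc n, hA (2 * n + 1), sq_nonneg (A 0)]
  have hG := tsum_partialSum_mul_pow (B := fun k => A (k + 1) ^ 2) (fun n => by positivity)
    hT1 hq hq1
  have hTs := summable_bounded_mul_pow hT0 hT1 hq hq1
  have hBs : Summable fun n => A (n + 1) ^ 2 * (r ^ 2) ^ (n + 1) :=
    ((summable_bounded_mul_pow (A := fun n => A (n + 1) ^ 2) (fun n => by positivity)
      (fun n => pow_le_one₀ (hA _) (hA1 _)) hq hq1).mul_left (r ^ 2)).congr fun n => by ring
  have hf : Summable fun n => A n * r ^ n := summable_bounded_mul_pow hA hA1 hr hr1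
  have hs0 : Summable fun n => A (2 * n + 1) * r ^ (2 * n + 1) :=
    hf.comp_injective fun a b h => by simpa using h
  have hs1 : Summable fun n => A (2 * (n + 1)) * r ^ (2 * (n + 1)) :=
    hf.comp_injective fun a b h => by simpa using h
  have hsplit : ∑' n, A (n + 1) * r ^ (n + 1) = ∑' n, A (2 * n + 1) * r ^ (2 * n + 1) +
      ∑' n, A (2 * (n + 1)) * r ^ (2 * (n + 1)) :=
    (tsum_even_add_odd (f := fun n => A (n + 1) * r ^ (n + 1)) hs0 hs1).symm
  have h0 := tsum_odd_mul_pow_le (D := 1 - A 0 ^ 2) hr hr1 hs0 hTs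
    fun n => by linarith [hodd n, hsucc n]
  have h1 := tsum_even_mul_pow_le (D := 1 - A 0 ^ 2) (E := 1 / (1 + A 0)) hr hr1 hs1 hTs hBs
    fun n => by
      have := heven n
      rw [div_eq_mul_one_div, mul_comm (A (n + 1) ^ 2)] at this
      linarith [hsucc n]
  have hid := geometric_split_identity (D := 1 - A 0 ^ 2) (E := 1 / (1 + A 0)) hr hr1 hG
  simp_rw [pow_mul r 2] at h1 hsplit ⊢
  linarith

theorem hasSum_succ_mul_geometric {x : ℝ} (hx : 0 ≤ x) (hx1 : x < 1) :
    HasSum (fun n : ℕ => (n + 1 : ℝ) * x ^ n) (1 / (1 - x) ^ 2) := by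
  have h1 := hasSum_coe_mul_geometric_of_norm_lt_one (𝕜 := ℝ) (r := x)
    (by rwa [Real.norm_of_nonneg hx])
  have h2 := h1.add (hasSum_geometric_of_lt_one hx hx1)
  have : 1 - x ≠ 0 := by linarith
  have e1 : (fun n : ℕ => (n + 1 : ℝ) * x ^ n) = fun n : ℕ => n * x ^ n + x ^ n := by
    funext n; ring
  have e2 : 1 / (1 - x) ^ 2 = x / (1 - x) ^ 2 + (1 - x)⁻¹ := by field_simp; ring
  rw [e1, e2]; exact h2

theorem summable_succ_mul_bounded_mul_pow {A : ℕ → ℝ} {C q : ℝ} (hA : ∀ n, 0 ≤ A n)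
    (hAC : ∀ n, A n ≤ C) (hq : 0 ≤ q) (hq1 : q < 1) :
    Summable fun n : ℕ => (n + 1) * A n * q ^ (n + 1) := by
  refine Summable.of_nonneg_of_le (fun n => ?_) (fun n => ?_)
    ((hasSum_succ_mul_geometric hq hq1).summable.mul_left (C * q))
  · have := hA n; positivity
  · calc (n + 1) * A n * q ^ (n + 1) ≤ (n + 1) * C * q ^ (n + 1) := by
          have := hAC n; gcongr
      _ = _ := by ring

/-- Abel summation with the weights `n qⁿ`, which decrease for `q ≤ 1 / 2`. -/
theorem sum_succ_mul_pow_le {A B : ℕ → ℝ} {q : ℝ} (hq : 0 ≤ q) (hq2 : q ≤ 1 / 2)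
    (hAB : ∀ n, ∑ k ∈ Finset.range n, A k ≤ ∑ k ∈ Finset.range n, B k) (n : ℕ) :
    n * q ^ n * (∑ k ∈ Finset.range n, B k - ∑ k ∈ Finset.range n, A k) ≤
      ∑ k ∈ Finset.range n, (k + 1) * B k * q ^ (k + 1) -
      ∑ k ∈ Finset.range n, (k + 1) * A k * q ^ (k + 1) := by
  induction n with
  | zero => simp
  | succ n ih =>
    have hD := hAB n
    have hw : ((n + 1 : ℕ) : ℝ) * q ^ (n + 1) *
        (∑ k ∈ Finset.range n, B k - ∑ k ∈ Finset.range n, A k) ≤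
        n * q ^ n * (∑ k ∈ Finset.range n, B k - ∑ k ∈ Finset.range n, A k) := by
      rcases n with _ | n
      · simp
      · refine mul_le_mul_of_nonneg_right ?_ (by linarith)
        have h1 : ((n + 1 + 1 : ℕ) : ℝ) * q ≤ ((n + 1 : ℕ) : ℝ) := by
          push_cast
          have : (0 : ℝ) ≤ n := by positivity
          nlinarith
        calc _ = (((n + 1 + 1 : ℕ) : ℝ) * q) * q ^ (n + 1) := by ring
          _ ≤ _ := by gcongr
    rw [Finset.sum_range_succ, Finset.sum_range_succ, Finset.sum_range_succ _ n,
      Finset.sum_range_succ _ n]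
    push_cast at hw ⊢
    linarith

theorem tsum_succ_mul_pow_le {A B : ℕ → ℝ} {q C : ℝ} (hq : 0 ≤ q) (hq2 : q ≤ 1 / 2)
    (hA : ∀ n, 0 ≤ A n) (hAC : ∀ n, A n ≤ C) (hB : ∀ n, 0 ≤ B n) (hBC : ∀ n, B n ≤ C)
    (hAB : ∀ n, ∑ k ∈ Finset.range n, A k ≤ ∑ k ∈ Finset.range n, B k) :
    ∑' n : ℕ, (n + 1) * A n * q ^ (n + 1) ≤ ∑' n : ℕ, (n + 1) * B n * q ^ (n + 1) := by
  have hq1 : q < 1 := by linarith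
  have hsA := summable_succ_mul_bounded_mul_pow hA hAC hq hq1
  have hsB := summable_succ_mul_bounded_mul_pow hB hBC hq hq1
  refine le_of_tendsto_of_tendsto' hsA.hasSum.tendsto_sum_nat hsB.hasSum.tendsto_sum_nat
    fun n => ?_
  have h1 := sum_succ_mul_pow_le hq hq2 hAB n
  have h2 : 0 ≤ n * q ^ n * (∑ k ∈ Finset.range n, B k - ∑ k ∈ Finset.range n, A k) :=
    mul_nonneg (by positivity) (by linarith [hAB n])
  linarith

namespace IsAnalyticSelfMap

variable {f : ℂ → ℂ}

theorem norm_coeff_le_one (hf : IsAnalyticSelfMap f) (n : ℕ) : ‖taylorCoeff f n‖ ≤ 1 :=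
  hf.hasDiskSeries.norm_coeff_le_one (fun _ hz => (hf.norm_lt_one hz).le) n

theorem refined_bohr_le (hf : IsAnalyticSelfMap f) {r : ℝ} (hr : 0 ≤ r) (hr1 : r < 1) :
    ∑' n, ‖taylorCoeff f (n + 1)‖ * r ^ (n + 1) +
      (1 / (1 + ‖taylorCoeff f 0‖) + r / (1 - r)) *
        ∑' n, ‖taylorCoeff f (n + 1)‖ ^ 2 * r ^ (2 * (n + 1)) ≤
      (1 - ‖taylorCoeff f 0‖ ^ 2) * (r / (1 - r)) :=
  have hh : ∀ z : ℂ, ‖z‖ < 1 → ‖f z‖ ≤ 1 := fun _ hz => (hf.norm_lt_one hz).le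
  tsum_mul_pow_add_le (fun _ => norm_nonneg _) hf.norm_coeff_le_one
    (hf.hasDiskSeries.norm_odd_add_sum_sq_le_one hh)
    (fun _ => hf.hasDiskSeries.norm_even_add_sum_sq_le_one hh (by omega)) hr hr1

theorem summable_sq_coeff (hf : IsAnalyticSelfMap f) {r : ℝ} (hr : 0 ≤ r) (hr1 : r < 1) :
    Summable fun n : ℕ => ‖taylorCoeff f (n + 1)‖ ^ 2 * r ^ (2 * (n + 1)) := by
  have := summable_bounded_mul_pow (A := fun n => ‖taylorCoeff f (n + 1)‖ ^ 2) (C := 1)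
    (q := r ^ 2) (fun n => by positivity)
    (fun n => pow_le_one₀ (norm_nonneg _) (hf.norm_coeff_le_one _)) (by positivity) (by nlinarith)
  refine (this.mul_left (r ^ 2)).congr fun n => ?_
  ring

theorem summable_succ_mul_sq_coeff (hf : IsAnalyticSelfMap f) {r : ℝ} (hr : 0 ≤ r) (hr1 : r < 1) :
    Summable fun n : ℕ => (n + 1) * ‖taylorCoeff f (n + 1)‖ ^ 2 * (r ^ 2) ^ (n + 1) :=
  summable_succ_mul_bounded_mul_pow (C := 1) (fun n => by positivity)
    (fun n => pow_le_one₀ (norm_nonneg _) (hf.norm_coeff_le_one _)) (by positivity) (by nlinarith)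

theorem tsum_succ_mul_sq_coeff_le (hf : IsAnalyticSelfMap f) {r : ℝ} (hr2 : r ^ 2 ≤ 1 / 2) :
    ∑' n : ℕ, (n + 1) * ‖taylorCoeff f (n + 1)‖ ^ 2 * (r ^ 2) ^ (n + 1) ≤
      (1 - ‖taylorCoeff f 0‖ ^ 2) ^ 2 * r ^ 2 / (1 - ‖taylorCoeff f 0‖ ^ 2 * r ^ 2) ^ 2 := by
  have ha := hf.norm_coeff_zero_lt_one
  have ha0 := norm_nonneg (taylorCoeff f 0)
  have hsum := hf.sum_sq_coeff_succ_le
  set a := ‖taylorCoeff f 0‖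
  have hp1 : a ^ 2 < 1 := by nlinarith
  have hp0 : 0 ≤ a ^ 2 := by positivity
  have hq0 : 0 ≤ r ^ 2 := by positivity
  refine (tsum_succ_mul_pow_le (C := 1) hq0 hr2 (fun n => by positivity)
    (fun n => pow_le_one₀ (norm_nonneg _) (hf.norm_coeff_le_one _)) (fun n => by positivity)
    (fun n => ?_) hsum).trans (le_of_eq ?_)
  · exact mul_le_one₀ (by nlinarith) (by positivity) (pow_le_one₀ hp0 hp1.le)
  · have h1 := (hasSum_succ_mul_geometric (x := a ^ 2 * r ^ 2) (by positivity)
      (by nlinarith)).mul_left ((1 - a ^ 2) ^ 2 * r ^ 2)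
    rw [mul_one_div] at h1
    rw [← h1.tsum_eq]
    exact tsum_congr fun n => by ring

end IsAnalyticSelfMap

theorem abs_det_restrictScalars_toSpanSingleton (a : ℂ) :
    |((ContinuousLinearMap.toSpanSingleton ℂ a).restrictScalars ℝ).det| = ‖a‖ ^ 2 := by
  simp [ContinuousLinearMap.det, LinearMap.det_restrictScalars, Algebra.norm_complex_eq,
    Complex.normSq_eq_norm_sq]

theorem AnalyticAt.exists_isOpen_injOn {f : ℂ → ℂ} {z : ℂ} (hf : AnalyticAt ℂ f z)
    (hz : deriv f z ≠ 0) : ∃ V : Set ℂ, IsOpen V ∧ z ∈ V ∧ Set.InjOn f V := by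
  have h := (hf.hasStrictDerivAt).hasStrictFDerivAt_equiv hz
  exact ⟨_, (h.toOpenPartialHomeomorph f).open_source, h.mem_toOpenPartialHomeomorph_source,
    (h.toOpenPartialHomeomorph f).injOn⟩

theorem exists_seq_measurable_injOn {f : ℂ → ℂ} {V : Set ℂ} (hV : IsOpen V)
    (hf : AnalyticOnNhd ℂ f V) (hf' : ∀ z ∈ V, deriv f z ≠ 0) :
    ∃ D : ℕ → Set ℂ, (∀ n, MeasurableSet (D n)) ∧ (∀ n, Set.InjOn f (D n)) ∧
      Pairwise (Function.onFun Disjoint D) ∧ ⋃ n, D n = V := by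
  have hN : ∀ z : ℂ, ∃ N : Set ℂ, IsOpen N ∧ Set.InjOn f N ∧ N ⊆ V ∧ (z ∈ V → z ∈ N) := by
    intro z
    by_cases hz : z ∈ V
    · obtain ⟨N, hN, hzN, hinj⟩ := (hf z hz).exists_isOpen_injOn (hf' z hz)
      exact ⟨N ∩ V, hN.inter hV, hinj.mono Set.inter_subset_left, Set.inter_subset_right,
        fun _ => ⟨hzN, hz⟩⟩
    · exact ⟨∅, isOpen_empty, Set.injOn_empty f, Set.empty_subset _, fun h => (hz h).elim⟩
  choose N hNo hNi hNV hNz using hN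
  obtain ⟨t, -, htc, hVt⟩ := TopologicalSpace.countable_cover_nhdsWithin (f := N) (s := V)
    fun z hz => mem_nhdsWithin_of_mem_nhds ((hNo z).mem_nhds (hNz z hz))
  obtain ⟨e, he⟩ := (htc.insert 0).exists_eq_range (Set.insert_nonempty 0 t)
  refine ⟨disjointed fun n => N (e n), fun n => MeasurableSet.disjointed
    (fun n => (hNo (e n)).measurableSet) n, fun n => (hNi (e n)).mono (disjointed_subset _ n),
    disjoint_disjointed _, ?_⟩
  rw [iUnion_disjointed]
  refine Set.Subset.antisymm (Set.iUnion_subset fun n => hNV _) fun z hz => ?_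
  obtain ⟨x, hx, hzx⟩ := Set.mem_iUnion₂.1 (hVt hz)
  have : x ∈ Set.range e := he ▸ Set.mem_insert_of_mem 0 hx
  obtain ⟨n, rfl⟩ := this
  exact Set.mem_iUnion.2 ⟨n, hzx⟩

/-- The area formula, with multiplicity, for analytic functions of one variable. -/
theorem lintegral_encard_preimage {f : ℂ → ℂ} {U : Set ℂ} (hU : IsOpen U)
    (hf : AnalyticOnNhd ℂ f U) :
    ∫⁻ w : ℂ, (({z : ℂ | z ∈ U ∧ f z = w}.encard : ℕ∞) : ℝ≥0∞) =
      ∫⁻ z in U, ENNReal.ofReal (‖deriv f z‖ ^ 2) := by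
  set f' : ℂ → ℂ →L[ℝ] ℂ := fun z =>
    (ContinuousLinearMap.toSpanSingleton ℂ (deriv f z)).restrictScalars ℝ with hf'def
  have hdet : ∀ z, |(f' z).det| = ‖deriv f z‖ ^ 2 := fun z =>
    abs_det_restrictScalars_toSpanSingleton _
  have hfd : ∀ z ∈ U, HasFDerivAt f (f' z) z := fun z hz =>
    ((hf z hz).differentiableAt.hasDerivAt.hasFDerivAt).restrictScalars ℝ
  set V : Set ℂ := U ∩ {z | deriv f z ≠ 0} with hVdef
  set Z : Set ℂ := U ∩ {z | deriv f z = 0} with hZdef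
  have hVo : IsOpen V := hf.deriv.continuousOn.isOpen_inter_preimage hU isOpen_ne
  have hZm : MeasurableSet Z := by
    have : Z = U \ V := by ext z; simp [hVdef, hZdef]
    rw [this]; exact hU.measurableSet.diff hVo.measurableSet
  have hUVZ : U = V ∪ Z := by ext z; simp [hVdef, hZdef]; tauto
  have hdisj : Disjoint V Z := Set.disjoint_left.2 fun z hz hz' => hz.2 hz'.2
  have hnull : volume (f '' Z) = 0 :=
    addHaar_image_eq_zero_of_det_fderivWithin_eq_zero volume (f' := f')
      (fun z hz => (hfd z hz.1).hasFDerivWithinAt) (fun z hz => by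
        rw [← abs_eq_zero, hdet, show deriv f z = 0 from hz.2]; simp)
  obtain ⟨D, hDm, hDi, hDd, hDV⟩ := exists_seq_measurable_injOn hVo
    (hf.mono Set.inter_subset_left) fun z hz => hz.2
  have hDU : ∀ n, D n ⊆ U := fun n => by
    rw [hUVZ, ← hDV]; exact (Set.subset_iUnion D n).trans Set.subset_union_left
  have hcount : ∀ w, w ∉ f '' Z → (({z : ℂ | z ∈ U ∧ f z = w}.encard : ℕ∞) : ℝ≥0∞) =
      ∑' n, (f '' D n).indicator 1 w := by
    intro w hw
    have hsub : ∀ n, {z : ℂ | z ∈ D n ∧ f z = w}.Subsingleton := fun n x hx y hy =>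
      hDi n hx.1 hy.1 (hx.2.trans hy.2.symm)
    have hset : {z : ℂ | z ∈ U ∧ f z = w} = ⋃ n, {z : ℂ | z ∈ D n ∧ f z = w} := by
      ext z
      simp only [Set.mem_ofPred_eq, Set.mem_iUnion, exists_and_right]
      refine and_congr_left fun hz => ?_
      rw [← Set.mem_iUnion, hDV]
      refine ⟨fun h => ⟨h, fun h0 => hw ⟨z, ⟨h, h0⟩, hz⟩⟩, fun h => h.1⟩
    have hm : ∀ n, MeasurableSet {z : ℂ | z ∈ D n ∧ f z = w} := fun n => (hsub n).measurableSet
    rw [← Measure.count_apply (by rw [hset]; exact MeasurableSet.iUnion hm), hset,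
      measure_iUnion (fun i j hij => (hDd hij).mono (fun _ h => h.1) (fun _ h => h.1)) hm]
    refine tsum_congr fun n => ?_
    rw [Measure.count_apply (hm n)]
    by_cases hwn : w ∈ f '' D n
    · obtain ⟨z, hz, rfl⟩ := hwn
      have : {y : ℂ | y ∈ D n ∧ f y = f z} = {z} :=
        (hsub n).eq_singleton_of_mem ⟨hz, rfl⟩
      rw [this, Set.indicator_of_mem (Set.mem_image_of_mem f hz)]; simp
    · have : {y : ℂ | y ∈ D n ∧ f y = w} = ∅ :=
        Set.eq_empty_of_forall_notMem fun y hy => hwn ⟨y, hy.1, hy.2⟩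
      rw [this, Set.indicator_of_notMem hwn]; simp
  have hae : ∀ᵐ w : ℂ, (({z : ℂ | z ∈ U ∧ f z = w}.encard : ℕ∞) : ℝ≥0∞) =
      ∑' n, (f '' D n).indicator 1 w := by
    filter_upwards [compl_mem_ae_iff.2 hnull] with w hw using hcount w hw
  have hDf : ∀ n, ∀ z ∈ D n, HasFDerivWithinAt f (f' z) (D n) z := fun n z hz =>
    (hfd z (hDU n hz)).hasFDerivWithinAt
  have him : ∀ n, MeasurableSet (f '' D n) := fun n =>
    measurable_image_of_fderivWithin (hDm n) (hDf n) (hDi n)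
  rw [lintegral_congr_ae hae, lintegral_tsum fun n =>
    (measurable_one.indicator (him n)).aemeasurable]
  have hZ0 : ∫⁻ z in Z, ENNReal.ofReal (‖deriv f z‖ ^ 2) = 0 := by
    rw [setLIntegral_congr_fun hZm (g := fun _ => 0) fun z hz => by
      simp [show deriv f z = 0 from hz.2]]
    simp
  rw [hUVZ, lintegral_union hZm hdisj, hZ0, add_zero, ← hDV, lintegral_iUnion hDm hDd]
  refine tsum_congr fun n => ?_
  rw [lintegral_indicator_one (him n), ← lintegral_abs_det_fderiv_eq_addHaar_image volume (hDm n)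
    (hDf n) (hDi n)]
  simp_rw [hdet]

theorem setLIntegral_ball_eq_polar {g : ℂ → ℝ≥0∞} (hg : Measurable g) (r : ℝ) :
    ∫⁻ z in Metric.ball (0 : ℂ) r, g z = ∫⁻ ρ in Set.Ioo 0 r, ENNReal.ofReal ρ *
      ∫⁻ θ in Set.Ioo (-Real.pi) Real.pi, g (ρ * Complex.exp (θ * Complex.I)) := by
  have hexp : ∀ p : ℝ × ℝ, Complex.polarCoord.symm p = p.1 * Complex.exp (p.2 * Complex.I) := by
    intro p
    rw [Complex.polarCoord_symm_apply, Complex.exp_mul_I]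
    simp
  rw [← lintegral_indicator Metric.isOpen_ball.measurableSet,
    ← Complex.lintegral_comp_polarCoord_symm]
  simp_rw [hexp]
  have hpt : polarCoord.target = Set.Ioi (0 : ℝ) ×ˢ Set.Ioo (-Real.pi) Real.pi := rfl
  have hm1 : Measurable ((Metric.ball (0 : ℂ) r).indicator g) :=
    hg.indicator Metric.isOpen_ball.measurableSet
  have hm : Measurable fun p : ℝ × ℝ => ENNReal.ofReal p.1 •
      (Metric.ball (0 : ℂ) r).indicator g (p.1 * Complex.exp (p.2 * Complex.I)) := by
    have : Measurable fun p : ℝ × ℝ => (p.1 * Complex.exp (p.2 * Complex.I) : ℂ) := by fun_prop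
    exact (ENNReal.measurable_ofReal.comp measurable_fst).smul (hm1.comp this)
  rw [hpt, Measure.volume_eq_prod, setLIntegral_prod _ hm.aemeasurable,
    ← lintegral_indicator measurableSet_Ioi, ← lintegral_indicator measurableSet_Ioo]
  refine lintegral_congr fun ρ => ?_
  by_cases h0 : 0 < ρ
  · rw [Set.indicator_of_mem (Set.mem_Ioi.2 h0)]
    have hmem : ∀ θ : ℝ, (ρ * Complex.exp (θ * Complex.I) : ℂ) ∈ Metric.ball (0 : ℂ) r ↔ ρ < r := by
      intro θ
      simp [Complex.norm_exp_ofReal_mul_I, abs_of_pos h0]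
    by_cases hr : ρ < r
    · rw [Set.indicator_of_mem (Set.mem_Ioo.2 ⟨h0, hr⟩)]
      simp_rw [Set.indicator_of_mem ((hmem _).2 hr), smul_eq_mul]
      have : Measurable fun θ : ℝ => g (ρ * Complex.exp (θ * Complex.I)) :=
        hg.comp (by fun_prop)
      rw [lintegral_const_mul _ this]
    · rw [Set.indicator_of_notMem fun h => hr h.2]
      simp_rw [Set.indicator_of_notMem fun h => hr ((hmem _).1 h)]
      simp
  · rw [Set.indicator_of_notMem (by simpa using h0), Set.indicator_of_notMem fun h => h0 h.1]

theorem lintegral_Ioo_pow (k : ℕ) {r : ℝ} (hr : 0 ≤ r) :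
    ∫⁻ ρ in Set.Ioo 0 r, ENNReal.ofReal (ρ ^ k) = ENNReal.ofReal (r ^ (k + 1) / (k + 1)) := by
  rw [setLIntegral_congr Ioo_ae_eq_Ioc, ← ofReal_integral_eq_lintegral_ofReal]
  · rw [← intervalIntegral.integral_of_le hr, integral_pow]; simp
  · exact ((continuous_pow k).integrableOn_Icc (a := 0) (b := r)).mono_set Set.Ioc_subset_Icc_self
  · filter_upwards [ae_restrict_mem measurableSet_Ioc] with ρ hρ
    exact pow_nonneg hρ.1.le k

/-- The area, with multiplicity, of the image of a disk in terms of Taylor coefficients. -/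
theorem imageArea_eq {f : ℂ → ℂ} (hf : AnalyticOnNhd ℂ f (Metric.ball 0 1)) {r : ℝ} (hr : 0 ≤ r)
    (hr1 : r < 1) :
    imageArea f r = ∑' n : ℕ, ENNReal.ofReal
      (Real.pi * ((n + 1) * ‖taylorCoeff f (n + 1)‖ ^ 2 * (r ^ 2) ^ (n + 1))) := by
  have hsub : Metric.ball (0 : ℂ) r ⊆ Metric.ball 0 1 := Metric.ball_subset_ball hr1.le
  rw [imageArea, lintegral_encard_preimage Metric.isOpen_ball (hf.mono hsub)]
  have hgm : Measurable fun z => ENNReal.ofReal (‖deriv f z‖ ^ 2) := by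
    have := measurable_deriv f
    fun_prop
  rw [setLIntegral_ball_eq_polar hgm]
  have hser := hasDiskSeries_deriv hf
  have hinner : ∀ ρ ∈ Set.Ioo 0 r, ENNReal.ofReal ρ * ∫⁻ θ in Set.Ioo (-Real.pi) Real.pi,
      ENNReal.ofReal (‖deriv f (ρ * Complex.exp (θ * Complex.I))‖ ^ 2) =
      ∑' n : ℕ, ENNReal.ofReal (2 * Real.pi * ((n + 1) ^ 2 * ‖taylorCoeff f (n + 1)‖ ^ 2)) *
        ENNReal.ofReal (ρ ^ (2 * n + 1)) := by
    intro ρ hρ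
    have hρ0 : 0 < ρ := hρ.1
    obtain ⟨hc, hs⟩ := hser.parseval hρ.1.le (hρ.2.trans hr1)
    have hpi : -Real.pi ≤ Real.pi := by linarith [Real.pi_pos]
    rw [setLIntegral_congr Ioo_ae_eq_Ioc, ← ofReal_integral_eq_lintegral_ofReal,
      ← intervalIntegral.integral_of_le hpi, ← hs.tsum_eq,
      ENNReal.ofReal_tsum_of_nonneg (fun n => by positivity) hs.summable, ← ENNReal.tsum_mul_left]
    · refine tsum_congr fun n => ?_
      rw [← ENNReal.ofReal_mul hρ.1.le, ← ENNReal.ofReal_mul (by positivity)]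
      congr 1
      have : ‖(n + 1 : ℂ)‖ = n + 1 := by exact_mod_cast Complex.norm_natCast (n + 1)
      rw [norm_mul, this]; ring
    · exact ((hc.norm.pow 2).integrableOn_Icc (a := -Real.pi) (b := Real.pi)).mono_set
        Set.Ioc_subset_Icc_self
    · exact ae_of_all _ fun θ => sq_nonneg _
  rw [setLIntegral_congr_fun measurableSet_Ioo hinner, lintegral_tsum fun n => by fun_prop]
  refine tsum_congr fun n => ?_
  rw [lintegral_const_mul _ (by fun_prop), lintegral_Ioo_pow _ hr,
    ← ENNReal.ofReal_mul (by positivity)]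
  congr 1
  have : (n + 1 : ℝ) ≠ 0 := by positivity
  push_cast
  rw [show (2 * n + 1 + 1 : ℝ) = 2 * (n + 1) by ring, ← pow_mul]
  field_simp
  ring

namespace IsAnalyticSelfMap

variable {f : ℂ → ℂ}

theorem imageArea_eq_ofReal (hf : IsAnalyticSelfMap f) {r : ℝ} (hr : 0 ≤ r) (hr1 : r < 1) :
    imageArea f r = ENNReal.ofReal (Real.pi *
      ∑' n : ℕ, (n + 1) * ‖taylorCoeff f (n + 1)‖ ^ 2 * (r ^ 2) ^ (n + 1)) := by
  rw [imageArea_eq hf.analytic hr hr1, ← tsum_mul_left,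
    ENNReal.ofReal_tsum_of_nonneg (fun n => by positivity)
      ((hf.summable_succ_mul_sq_coeff hr hr1).mul_left _)]

theorem imageArea_toReal_div_pi (hf : IsAnalyticSelfMap f) {r : ℝ} (hr : 0 ≤ r) (hr1 : r < 1) :
    (imageArea f r).toReal / Real.pi =
      ∑' n : ℕ, (n + 1) * ‖taylorCoeff f (n + 1)‖ ^ 2 * (r ^ 2) ^ (n + 1) := by
  rw [hf.imageArea_eq_ofReal hr hr1, ENNReal.toReal_ofReal (by positivity),
    mul_div_cancel_left₀ _ Real.pi_ne_zero]

end IsAnalyticSelfMap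

/-- The extremal value of the Bohr sum without its initial term. -/
noncomputable def bohrTailBound (c a r : ℝ) : ℝ :=
  (1 - a ^ 2) * (r / (1 - r)) + c * ((1 - a ^ 2) ^ 2 * r ^ 2 / (1 - a ^ 2 * r ^ 2) ^ 2)

theorem bohrTailBound_mono {c a r R : ℝ} (hc : 0 ≤ c) (ha : 0 ≤ a) (ha1 : a < 1) (hr : 0 ≤ r)
    (hrR : r ≤ R) (hR : R < 1) : bohrTailBound c a r ≤ bohrTailBound c a R := by
  have hp1 : a ^ 2 ≤ 1 := by nlinarith
  have hq : r ^ 2 ≤ R ^ 2 := by gcongr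
  have hq1 : R ^ 2 < 1 := by nlinarith
  have h1 : 0 < 1 - a ^ 2 * R ^ 2 := by nlinarith [sq_nonneg a, sq_nonneg R]
  have h2 : 0 ≤ 1 - a ^ 2 := by linarith
  have h3 : 0 < 1 - R := by linarith
  have h4 : 0 ≤ R := hr.trans hrR
  unfold bohrTailBound
  gcongr

namespace IsAnalyticSelfMap

variable {f : ℂ → ℂ}

theorem bohrSumD_eq (hf : IsAnalyticSelfMap f) (c : ℝ) {r : ℝ} (hr : 0 ≤ r) (hr1 : r < 1) :
    bohrSumD c f r = ‖taylorCoeff f 0‖ +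
      (∑' n : ℕ, ‖taylorCoeff f (n + 1)‖ * r ^ (n + 1) + refinementTerm c f r) := by
  rw [bohrSumD, (hf.hasDiskSeries.summable_norm hr hr1).tsum_eq_zero_add]
  ring

theorem tail_le (hf : IsAnalyticSelfMap f) {c r : ℝ} (hc : 0 ≤ c) (hr : 0 ≤ r) (hr1 : r < 1)
    (hr2 : r ^ 2 ≤ 1 / 2) :
    ∑' n : ℕ, ‖taylorCoeff f (n + 1)‖ * r ^ (n + 1) + refinementTerm c f r ≤
      bohrTailBound c ‖taylorCoeff f 0‖ r := by
  have h1 := hf.refined_bohr_le hr hr1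
  have h2 := mul_le_mul_of_nonneg_left (hf.tsum_succ_mul_sq_coeff_le hr2) hc
  rw [refinementTerm, bohrTailBound, hf.imageArea_toReal_div_pi hr hr1]
  linarith

end IsAnalyticSelfMap

theorem add_bohrTailBound_one_third_le {a : ℝ} (ha : 0 ≤ a) (ha1 : a < 1) :
    a + bohrTailBound (8 / 9) a (1 / 3) ≤ 1 := by
  have h0 : 0 < 9 - a ^ 2 := by nlinarith
  have e : 1 - (a + bohrTailBound (8 / 9) a (1 / 3)) =
      (1 - a) ^ 2 * ((9 - a ^ 2) ^ 2 - (4 * (1 + a)) ^ 2) / (2 * (9 - a ^ 2) ^ 2) := by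
    have : 1 - a ^ 2 * (1 / 3) ^ 2 = (9 - a ^ 2) / 9 := by ring
    rw [bohrTailBound, this]
    field_simp
    ring
  have h1 : 4 * (1 + a) ≤ 9 - a ^ 2 := by nlinarith
  have h2 : (4 * (1 + a)) ^ 2 ≤ (9 - a ^ 2) ^ 2 := by gcongr
  have : 0 ≤ 1 - (a + bohrTailBound (8 / 9) a (1 / 3)) := by
    rw [e]
    have : 0 ≤ (9 - a ^ 2) ^ 2 - (4 * (1 + a)) ^ 2 := by linarith
    positivity
  linarith

theorem sq_add_bohrTailBound_eq (c : ℝ) {a : ℝ} (ha1 : a < 1) :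
    1 - (a ^ 2 + bohrTailBound c a (1 / (3 - a))) =
      (1 - a) ^ 2 * (1 + a) * (9 * (3 - 2 * a) ^ 2 - c * ((1 + a) * (3 - a) ^ 2 * (2 - a))) /
        (9 * (3 - 2 * a) ^ 2 * (2 - a)) := by
  have h1 : 3 - a ≠ 0 := by linarith
  have h2 : 2 - a ≠ 0 := by linarith
  have h3 : 3 - 2 * a ≠ 0 := by linarith
  have e1 : 1 / (3 - a) / (1 - 1 / (3 - a)) = 1 / (2 - a) := by
    have : 1 - 1 / (3 - a) = (2 - a) / (3 - a) := by field_simp; ring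
    rw [this]; field_simp
  have e2 : 1 - a ^ 2 * (1 / (3 - a)) ^ 2 = 3 * (3 - 2 * a) / (3 - a) ^ 2 := by
    field_simp; ring
  rw [bohrTailBound, e1, e2]
  obtain ⟨u, hu⟩ : ∃ u, u = 3 - 2 * a := ⟨_, rfl⟩
  rw [← hu] at h3 ⊢
  field_simp
  rw [hu]
  ring

theorem sq_add_bohrTailBound_le {a : ℝ} (ha : 0 ≤ a) (ha1 : a < 1) :
    a ^ 2 + bohrTailBound (9 / 8) a (1 / (3 - a)) ≤ 1 := by
  have h2 : 0 < 2 - a := by linarith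
  have h3 : 0 < 3 - 2 * a := by linarith
  have h4 : 0 ≤ 9 * (3 - 2 * a) ^ 2 - 9 / 8 * ((1 + a) * (3 - a) ^ 2 * (2 - a)) := by
    have : 9 * (3 - 2 * a) ^ 2 - 9 / 8 * ((1 + a) * (3 - a) ^ 2 * (2 - a)) =
        9 / 8 * ((1 - a) * (54 - 39 * a + 6 * a ^ 2 - a ^ 3)) := by ring
    rw [this]
    have h5 : 0 ≤ 54 - 39 * a + 6 * a ^ 2 - a ^ 3 := by
      have : a ^ 3 ≤ 1 := pow_le_one₀ ha ha1.le
      nlinarith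
    have : 0 ≤ 1 - a := by linarith
    positivity
  have h6 : 0 ≤ 1 - (a ^ 2 + bohrTailBound (9 / 8) a (1 / (3 - a))) := by
    rw [sq_add_bohrTailBound_eq _ ha1]
    positivity
  linarith

namespace IsAnalyticSelfMap

variable {f : ℂ → ℂ}

theorem bohrSumD_le_one (hf : IsAnalyticSelfMap f) {r : ℝ} (hr : 0 ≤ r) (hr3 : r ≤ 1 / 3) :
    bohrSumD (8 / 9) f r ≤ 1 := by
  rw [hf.bohrSumD_eq _ hr (by linarith)]
  have h1 := hf.tail_le (c := 8 / 9) (by norm_num) hr (by linarith) (by nlinarith)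
  have h2 := bohrTailBound_mono (c := 8 / 9) (by norm_num) (norm_nonneg (taylorCoeff f 0))
    hf.norm_coeff_zero_lt_one hr hr3 (by norm_num)
  have h3 := add_bohrTailBound_one_third_le (norm_nonneg _) hf.norm_coeff_zero_lt_one
  linarith

theorem bohrSumE_le_one (hf : IsAnalyticSelfMap f) {r : ℝ} (hr : 0 ≤ r)
    (hr3 : r ≤ 1 / (3 - ‖taylorCoeff f 0‖)) : bohrSumE (9 / 8) f r ≤ 1 := by
  have ha1 := hf.norm_coeff_zero_lt_one
  have hR : 1 / (3 - ‖taylorCoeff f 0‖) ≤ 1 / 2 :=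
    one_div_le_one_div_of_le (by norm_num) (by linarith)
  have h1 := hf.tail_le (c := 9 / 8) (by norm_num) hr (by linarith) (by nlinarith)
  have h2 := bohrTailBound_mono (c := 9 / 8) (by norm_num) (norm_nonneg (taylorCoeff f 0))
    ha1 hr hr3 (by linarith)
  have h3 := sq_add_bohrTailBound_le (norm_nonneg _) ha1
  rw [bohrSumE]
  linarith

end IsAnalyticSelfMap

/-- The disk automorphism exchanging `0` and `a`. -/
noncomputable def moebius (a : ℝ) (z : ℂ) : ℂ := (a - z) / (1 - a * z)

section moebius

variable {a : ℝ}

theorem one_sub_ofReal_mul_ne_zero (ha : 0 ≤ a) (ha1 : a < 1) {z : ℂ} (hz : ‖z‖ < 1) :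
    1 - (a : ℂ) * z ≠ 0 := by
  simpa using one_sub_conj_mul_ne_zero (a := (a : ℂ)) (by simpa [abs_of_nonneg ha] using ha1) hz

theorem isAnalyticSelfMap_moebius (ha : 0 ≤ a) (ha1 : a < 1) : IsAnalyticSelfMap (moebius a) where
  analytic := by
    refine DifferentiableOn.analyticOnNhd ?_ Metric.isOpen_ball
    unfold moebius
    refine DifferentiableOn.div (by fun_prop) (by fun_prop) fun z hz => ?_
    exact one_sub_ofReal_mul_ne_zero ha ha1 (by simpa using hz)
  mapsTo := by
    intro z hz
    have h := norm_moebius_lt_one (a := (a : ℂ)) (z := z) (by simpa [abs_of_nonneg ha] using ha1)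
      (by simpa using hz)
    rw [Complex.conj_ofReal, norm_div, norm_sub_rev, ← norm_div] at h
    simpa [moebius] using h

theorem hasDiskSeries_moebius (ha : 0 ≤ a) (ha1 : a < 1) :
    HasDiskSeries (fun n => Nat.casesOn n (a : ℂ) fun k => -((1 - a ^ 2) * a ^ k)) (moebius a) := by
  intro z hz
  have hne := one_sub_ofReal_mul_ne_zero ha ha1 hz
  have hlt : ‖(a : ℂ) * z‖ < 1 := by
    rw [norm_mul, Complex.norm_real, Real.norm_of_nonneg ha]
    nlinarith [norm_nonneg z]
  have h1 := (hasSum_geometric_of_norm_lt_one hlt).mul_left (-((1 - a ^ 2) * z) : ℂ)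
  rw [← hasSum_nat_add_iff' 1]
  have e1 : moebius a z - ∑ i ∈ Finset.range 1,
      (Nat.casesOn i (a : ℂ) fun k => -((1 - a ^ 2) * a ^ k) : ℂ) * z ^ i =
      -((1 - a ^ 2) * z) * (1 - a * z)⁻¹ := by
    rw [Finset.sum_range_one, pow_zero, mul_one, moebius]
    change (a - z) / (1 - a * z) - (a : ℂ) = _
    field_simp
    ring
  rw [e1]
  have e2 : (fun n : ℕ => -((1 - a ^ 2) * a ^ n) * z ^ (n + 1)) =
      fun n : ℕ => -((1 - a ^ 2) * z) * ((a : ℂ) * z) ^ n := by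
    funext n; rw [mul_pow]; ring
  exact e2 ▸ h1

theorem norm_taylorCoeff_moebius_zero (ha : 0 ≤ a) (ha1 : a < 1) :
    ‖taylorCoeff (moebius a) 0‖ = a := by
  have := congrFun ((isAnalyticSelfMap_moebius ha ha1).hasDiskSeries.unique
    (hasDiskSeries_moebius ha ha1)) 0
  rw [this]; simp [abs_of_nonneg ha]

theorem norm_taylorCoeff_moebius_succ (ha : 0 ≤ a) (ha1 : a < 1) (n : ℕ) :
    ‖taylorCoeff (moebius a) (n + 1)‖ = (1 - a ^ 2) * a ^ n := by
  have := congrFun ((isAnalyticSelfMap_moebius ha ha1).hasDiskSeries.unique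
    (hasDiskSeries_moebius ha ha1)) (n + 1)
  rw [this]
  have h : 0 ≤ (1 - a ^ 2) * a ^ n := mul_nonneg (by nlinarith) (by positivity)
  have e : (-((1 - (a : ℂ) ^ 2) * (a : ℂ) ^ n)) = -(((1 - a ^ 2) * a ^ n : ℝ) : ℂ) := by push_cast; rfl
  simp only [e]
  rw [norm_neg, Complex.norm_real, Real.norm_of_nonneg h]

theorem moebius_tail_eq (c : ℝ) (ha : 0 ≤ a) (ha1 : a < 1) {r : ℝ} (hr : 0 ≤ r) (hr1 : r < 1) :
    ∑' n : ℕ, ‖taylorCoeff (moebius a) (n + 1)‖ * r ^ (n + 1) + refinementTerm c (moebius a) r =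
      bohrTailBound c a r := by
  have hf := isAnalyticSelfMap_moebius ha ha1
  rw [refinementTerm, bohrTailBound, hf.imageArea_toReal_div_pi hr hr1,
    norm_taylorCoeff_moebius_zero ha ha1]
  simp_rw [norm_taylorCoeff_moebius_succ ha ha1]
  have har : a * r < 1 := by nlinarith
  have har0 : 0 ≤ a * r := by positivity
  have hpq : (a * r) ^ 2 < 1 := by nlinarith
  have s1 : ∑' n : ℕ, (1 - a ^ 2) * a ^ n * r ^ (n + 1) = (1 - a ^ 2) * r / (1 - a * r) := by
    rw [div_eq_mul_inv, ← tsum_geometric_of_lt_one har0 har, ← tsum_mul_left]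
    exact tsum_congr fun n => by rw [mul_pow]; ring
  have s2 : ∑' n : ℕ, ((1 - a ^ 2) * a ^ n) ^ 2 * r ^ (2 * (n + 1)) =
      (1 - a ^ 2) ^ 2 * r ^ 2 / (1 - (a * r) ^ 2) := by
    rw [div_eq_mul_inv, ← tsum_geometric_of_lt_one (by positivity) hpq, ← tsum_mul_left]
    exact tsum_congr fun n => by ring
  have s3 : ∑' n : ℕ, (n + 1) * ((1 - a ^ 2) * a ^ n) ^ 2 * (r ^ 2) ^ (n + 1) =
      (1 - a ^ 2) ^ 2 * r ^ 2 / (1 - a ^ 2 * r ^ 2) ^ 2 := by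
    rw [← mul_pow a r, div_eq_mul_one_div,
      ← (hasSum_succ_mul_geometric (by positivity) hpq).tsum_eq, ← tsum_mul_left]
    exact tsum_congr fun n => by ring
  rw [s1, s2, s3, ← add_assoc]
  congr 1
  have h1 : 1 - r ≠ 0 := by linarith
  have h2 : 1 + a ≠ 0 := by linarith
  have h3 : 1 - a * r ≠ 0 := by linarith
  have h4 : 1 + a * r ≠ 0 := by linarith
  have h5 : 1 - (a * r) ^ 2 = (1 - a * r) * (1 + a * r) := by ring
  rw [h5]
  field_simp
  ring

theorem bohrSumD_moebius (c : ℝ) (ha : 0 ≤ a) (ha1 : a < 1) {r : ℝ} (hr : 0 ≤ r) (hr1 : r < 1) :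
    bohrSumD c (moebius a) r = a + bohrTailBound c a r := by
  rw [(isAnalyticSelfMap_moebius ha ha1).bohrSumD_eq c hr hr1, moebius_tail_eq c ha ha1 hr hr1,
    norm_taylorCoeff_moebius_zero ha ha1]

theorem bohrSumE_moebius (c : ℝ) (ha : 0 ≤ a) (ha1 : a < 1) {r : ℝ} (hr : 0 ≤ r) (hr1 : r < 1) :
    bohrSumE c (moebius a) r = a ^ 2 + bohrTailBound c a r := by
  rw [bohrSumE, add_assoc, moebius_tail_eq c ha ha1 hr hr1, norm_taylorCoeff_moebius_zero ha ha1]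

end moebius

theorem exists_pos_near_one {φ : ℝ → ℝ} (hφ : Continuous φ) (h1 : 0 < φ 1) :
    ∃ a : ℝ, 0 ≤ a ∧ a < 1 ∧ 0 < φ a := by
  have h2 : ∀ᶠ a in 𝓝[<] (1 : ℝ), 0 < φ a :=
    (hφ.continuousAt.continuousWithinAt (s := Set.Iio 1)).eventually (lt_mem_nhds h1)
  have h3 : ∀ᶠ a in 𝓝[<] (1 : ℝ), a ∈ Set.Ico 0 1 := Ico_mem_nhdsLT zero_lt_one
  obtain ⟨a, ha, hφa⟩ := (h3.and h2).exists
  exact ⟨a, ha.1, ha.2, hφa⟩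

theorem exists_one_lt_bohrSumD {c r : ℝ} (hc : 0 ≤ c) (hr : 1 / 3 < r) (hr1 : r < 1) :
    ∃ f : ℂ → ℂ, IsAnalyticSelfMap f ∧ 1 < bohrSumD c f r := by
  have hr' : 0 < 1 - r := by linarith
  obtain ⟨a, ha, ha1, h⟩ := exists_pos_near_one (φ := fun a => (1 + a) * r - (1 - r))
    (by fun_prop) (by linarith)
  refine ⟨moebius a, isAnalyticSelfMap_moebius ha ha1, ?_⟩
  rw [bohrSumD_moebius c ha ha1 (by linarith) hr1, bohrTailBound]
  have h1 : 0 ≤ c * ((1 - a ^ 2) ^ 2 * r ^ 2 / (1 - a ^ 2 * r ^ 2) ^ 2) := by positivity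
  have h2 : a + (1 - a ^ 2) * (r / (1 - r)) - 1 =
      (1 - a) * ((1 + a) * r - (1 - r)) / (1 - r) := by
    field_simp; ring
  have h3 : 0 < (1 - a) * ((1 + a) * r - (1 - r)) / (1 - r) :=
    div_pos (mul_pos (by linarith) h) hr'
  linarith

theorem exists_one_lt_bohrSumD_one_third {c : ℝ} (hc : 8 / 9 < c) :
    ∃ f : ℂ → ℂ, IsAnalyticSelfMap f ∧ 1 < bohrSumD c f (1 / 3) := by
  obtain ⟨a, ha, ha1, h⟩ := exists_pos_near_one
    (φ := fun a => 18 * c * (1 + a) ^ 2 - (9 - a ^ 2) ^ 2) (by fun_prop) (by linarith)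
  refine ⟨moebius a, isAnalyticSelfMap_moebius ha ha1, ?_⟩
  rw [bohrSumD_moebius c ha ha1 (by norm_num) (by norm_num)]
  have h0 : 0 < 9 - a ^ 2 := by nlinarith
  have e : a + bohrTailBound c a (1 / 3) - 1 =
      (1 - a) ^ 2 * (18 * c * (1 + a) ^ 2 - (9 - a ^ 2) ^ 2) / (2 * (9 - a ^ 2) ^ 2) := by
    have : 1 - a ^ 2 * (1 / 3) ^ 2 = (9 - a ^ 2) / 9 := by ring
    rw [bohrTailBound, this]
    field_simp
    ring
  have h1 : 0 < 1 - a := by linarith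
  have : 0 < a + bohrTailBound c a (1 / 3) - 1 := by rw [e]; positivity
  linarith

theorem exists_one_lt_bohrSumE {c : ℝ} (hc : 9 / 8 < c) :
    ∃ f : ℂ → ℂ, IsAnalyticSelfMap f ∧ 1 < bohrSumE c f (1 / (3 - ‖taylorCoeff f 0‖)) := by
  obtain ⟨a, ha, ha1, h⟩ := exists_pos_near_one
    (φ := fun a => c * ((1 + a) * (3 - a) ^ 2 * (2 - a)) - 9 * (3 - 2 * a) ^ 2)
    (by fun_prop) (by linarith)
  refine ⟨moebius a, isAnalyticSelfMap_moebius ha ha1, ?_⟩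
  have h3 : 0 < 3 - a := by linarith
  rw [norm_taylorCoeff_moebius_zero ha ha1, bohrSumE_moebius c ha ha1 (by positivity)
    ((div_lt_one h3).2 (by linarith))]
  have e := sq_add_bohrTailBound_eq c ha1
  have h1 : 0 < 1 - a := by linarith
  have h2 : 0 < 2 - a := by linarith
  have h4 : 0 < 3 - 2 * a := by linarith
  have : (1 - a) ^ 2 * (1 + a) * (9 * (3 - 2 * a) ^ 2 - c * ((1 + a) * (3 - a) ^ 2 * (2 - a))) /
        (9 * (3 - 2 * a) ^ 2 * (2 - a)) < 0 :=
    div_neg_of_neg_of_pos (mul_neg_of_pos_of_neg (by positivity) (by linarith)) (by positivity)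
  linarith

theorem theorem4 :
    -- all the series converge and the area is finite for `0 ≤ r < 1`
    (∀ f : ℂ → ℂ, IsAnalyticSelfMap f → ∀ r : ℝ, 0 ≤ r → r < 1 →
      Summable (fun n : ℕ => ‖taylorCoeff f n‖ * r ^ n) ∧
      Summable (fun n : ℕ => ‖taylorCoeff f (n + 1)‖ ^ 2 * r ^ (2 * (n + 1))) ∧
      imageArea f r < ⊤) ∧
    -- the first inequality
    (∀ f : ℂ → ℂ, IsAnalyticSelfMap f → ∀ r : ℝ, 0 ≤ r → r ≤ 1 / 3 →
      bohrSumD (8 / 9) f r ≤ 1) ∧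
    -- the radius `1 / 3` cannot be improved
    (∀ r : ℝ, 1 / 3 < r → r < 1 →
      ∃ f : ℂ → ℂ, IsAnalyticSelfMap f ∧ 1 < bohrSumD (8 / 9) f r) ∧
    -- the constant `8 / 9` cannot be improved
    (∀ c : ℝ, 8 / 9 < c →
      ∃ f : ℂ → ℂ, IsAnalyticSelfMap f ∧ 1 < bohrSumD c f (1 / 3)) ∧
    -- the second inequality
    (∀ f : ℂ → ℂ, IsAnalyticSelfMap f → ∀ r : ℝ, 0 ≤ r → r ≤ 1 / (3 - ‖taylorCoeff f 0‖) →
      bohrSumE (9 / 8) f r ≤ 1) ∧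
    -- the constant `9 / 8` cannot be improved
    (∀ c : ℝ, 9 / 8 < c →
      ∃ f : ℂ → ℂ, IsAnalyticSelfMap f ∧
        1 < bohrSumE c f (1 / (3 - ‖taylorCoeff f 0‖))) := by
  refine ⟨fun f hf r hr hr1 => ⟨hf.hasDiskSeries.summable_norm hr hr1, hf.summable_sq_coeff hr hr1,
      hf.imageArea_eq_ofReal hr hr1 ▸ ENNReal.ofReal_lt_top⟩,
    fun f hf r hr hr3 => hf.bohrSumD_le_one hr hr3,
    fun r hr hr1 => exists_one_lt_bohrSumD (by norm_num) hr hr1,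
    fun c hc => exists_one_lt_bohrSumD_one_third hc,
    fun f hf r hr hr3 => hf.bohrSumE_le_one hr hr3,
    fun c hc => exists_one_lt_bohrSumE hc⟩
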